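/- For an integer $k\ge 0$ and real $x$ let $$E_k(x)=\sum_{j=0}^{k}\frac{x^j}{j!}$$ be the $k$-th partial sum of the Taylor series of the exponential function, and for real $z$ let $$\mathrm{erf}(z)=\frac1{\sqrt{2\pi}}\int_{-\infty}^{z}e^{-t^2/2}\,dt .$$ Then $$\frac{E_{n-1}(x)}{e^{x}}=\mathrm{erf}\Big(\frac{n-x}{\sqrt n}\Big)+O(n^{-1/2})\qquad\text{as } n\to+\infty,$$ uniformly in $x\in[0,+\infty)$; that is, there is an absolute constant $C$ such that $$\Big|\frac{E_{n-1}(x)}{e^{x}}-\mathrm{erf}\Big(\frac{n-x}{\sqrt n}\Big)\Big|\le\frac{C}{\sqrt n}$$ for all integers $n\ge1$ and all real $x\ge0$. -/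

import Mathlib

/-- The partial Taylor sum of the exponential function,
`E_k(x) = ∑_{j=0}^{k} x^j / j!`. -/
noncomputable def expPartialSum (k : ℕ) (x : ℝ) : ℝ :=
  ∑ j ∈ Finset.range (k + 1), 1 / (Nat.factorial j : ℝ) * x ^ j

/-- The error function in the probabilistic normalization
`erf(z) = (2π)^{-1/2} ∫_{-∞}^{z} e^{-t²/2} dt`. -/
noncomputable def gaussErf (z : ℝ) : ℝ :=
  1 / Real.sqrt (2 * Real.pi) * ∫ t in Set.Iic z, Real.exp (-(1 / 2) * t ^ 2)

open MeasureTheory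

/-! Put `N = n = k + 1`, `x = N(1 + r)`, `P(r) = E_k(x)/e^x` and `Q(r) = erf(-√N r)`. With `a = N^k
e^{-N}/k!` and `c = √(2π) √N a`, the derivative of `P - cQ` is `-Na((1+r)^k e^{-Nr} - e^{-Nr²/2})`.
For `|r| ≤ 1/4` a Taylor expansion of `log(1+r)` bounds it by a multiple of `Na |r| e^{-Nr²/12}`,
whose integral is `O(a) = O(N^{-1/2})` (`abs_sub_le_of_abs_deriv_le_gaussian`).

Chernoff bounds put `P` and `Q` within `O(N^{-1/2})` of 0 at `r = 1/4` and of 1 at `r = -1/4`;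
monotonicity extends this outward. Comparing the two endpoints also gives `1 - c = O(N^{-1/2})`, so
only the one-sided Stirling bound `c ≤ 1` is needed. -/

/-! ### The Gaussian distribution function -/

theorem integrable_exp_neg_half_sq :
    Integrable fun t : ℝ => Real.exp (-(1 / 2) * t ^ 2) :=
  integrable_exp_neg_mul_sq (by norm_num)

theorem hasDerivAt_gaussErf (z : ℝ) :
    HasDerivAt gaussErf (1 / Real.sqrt (2 * Real.pi) * Real.exp (-(1 / 2) * z ^ 2)) z := by
  have hint := integrable_exp_neg_half_sq
  have hc : Continuous fun t : ℝ => Real.exp (-(1 / 2) * t ^ 2) := by fun_prop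
  have h := (intervalIntegral.integral_hasDerivAt_right (hc.intervalIntegrable 0 z)
    hc.stronglyMeasurable.stronglyMeasurableAtFilter hc.continuousAt).add_const
    (∫ t in Set.Iic (0 : ℝ), Real.exp (-(1 / 2) * t ^ 2))
  have h' := h.const_mul (1 / Real.sqrt (2 * Real.pi))
  refine h'.congr_of_eventuallyEq (Filter.Eventually.of_forall fun y => ?_)
  simp only [gaussErf]
  rw [← intervalIntegral.integral_Iic_sub_Iic hint.integrableOn hint.integrableOn]
  ring

theorem gaussErf_nonneg (z : ℝ) : 0 ≤ gaussErf z :=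
  mul_nonneg (by positivity) (setIntegral_nonneg measurableSet_Iic fun _ _ => (Real.exp_pos _).le)

theorem monotone_gaussErf : Monotone gaussErf :=
  monotone_of_hasDerivAt_nonneg hasDerivAt_gaussErf fun z => by
    show 0 ≤ 1 / Real.sqrt (2 * Real.pi) * Real.exp (-(1 / 2) * z ^ 2)
    positivity

theorem gaussErf_add_gaussErf_neg (z : ℝ) : gaussErf z + gaussErf (-z) = 1 := by
  have hint := integrable_exp_neg_half_sq
  have h1 := integral_comp_neg_Iic (-z) fun t : ℝ => Real.exp (-(1 / 2) * t ^ 2)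
  simp only [neg_sq, neg_neg] at h1
  simp only [gaussErf]
  rw [h1, ← mul_add, intervalIntegral.integral_Iic_add_Ioi hint.integrableOn hint.integrableOn,
    integral_gaussian, show Real.pi / (1 / 2) = 2 * Real.pi by ring]
  exact one_div_mul_cancel (by positivity)

theorem gaussErf_neg_le {a : ℝ} (ha : 0 < a) : gaussErf (-a) ≤ 2 / a := by
  have h1 : ∫ t in Set.Iic (-a), Real.exp (-(1 / 2) * t ^ 2) ≤ 2 / a := by
    calc ∫ t in Set.Iic (-a), Real.exp (-(1 / 2) * t ^ 2)
        ≤ ∫ t in Set.Iic (-a), Real.exp (a / 2 * t) := by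
          -- For `t ≤ -a` one has `t² ≥ -at`.
          refine setIntegral_mono_on integrable_exp_neg_half_sq.integrableOn
            (integrableOn_exp_mul_Iic (by positivity) _) measurableSet_Iic fun t ht => ?_
          rw [Set.mem_Iic] at ht
          apply Real.exp_le_exp.2
          nlinarith
      _ = Real.exp (a / 2 * -a) / (a / 2) := integral_exp_mul_Iic (by positivity) _
      _ ≤ 1 / (a / 2) := by
          gcongr
          rw [Real.exp_le_one_iff]
          nlinarith
      _ = 2 / a := by field_simp
  have h2 : 1 / Real.sqrt (2 * Real.pi) ≤ 1 := by
    rw [div_le_one (by positivity), Real.one_le_sqrt]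
    linarith [Real.pi_gt_three]
  calc gaussErf (-a) ≤ 1 * (2 / a) := by
        unfold gaussErf
        gcongr
    _ = 2 / a := one_mul _

/-! ### Partial sums of the exponential series -/

theorem expPartialSum_succ (k : ℕ) (x : ℝ) :
    expPartialSum (k + 1) x = expPartialSum k x + 1 / ((k + 1).factorial : ℝ) * x ^ (k + 1) :=
  Finset.sum_range_succ _ _

theorem hasDerivAt_expPartialSum_div_exp (k : ℕ) (x : ℝ) :
    HasDerivAt (fun x => expPartialSum k x / Real.exp x)
      (-(x ^ k / (k.factorial : ℝ) * Real.exp (-x))) x := by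
  simp only [div_eq_mul_inv, ← Real.exp_neg]
  have he : HasDerivAt (fun x : ℝ => Real.exp (-x)) (-Real.exp (-x)) x := by
    simpa using (hasDerivAt_neg x).exp
  induction k with
  | zero => simpa [expPartialSum] using he
  | succ k ih =>
    have h := ih.add ((((hasDerivAt_pow (k + 1) x).const_mul
      (1 / ((k + 1).factorial : ℝ))).mul he))
    convert! h using 1
    · funext y
      simp only [expPartialSum_succ, Pi.add_apply, Pi.mul_apply]
      ring
    · simp only [Nat.factorial_succ, Nat.add_sub_cancel]
      push_cast
      field_simp
      ring

theorem expPartialSum_nonneg (k : ℕ) {x : ℝ} (hx : 0 ≤ x) : 0 ≤ expPartialSum k x :=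
  Finset.sum_nonneg fun _ _ => by positivity

theorem hasSum_exp_series (x : ℝ) :
    HasSum (fun j : ℕ => 1 / (j.factorial : ℝ) * x ^ j) (Real.exp x) := by
  have h := NormedSpace.expSeries_div_hasSum_exp x
  rw [← Real.exp_eq_exp_ℝ] at h
  refine h.congr_fun fun j => ?_
  ring

theorem expPartialSum_le_exp (k : ℕ) {x : ℝ} (hx : 0 ≤ x) : expPartialSum k x ≤ Real.exp x :=
  sum_le_hasSum _ (fun _ _ => by positivity) (hasSum_exp_series x)

/-- Chernoff's method for the lower Poisson tail: `t^(k+1) ≤ t^j` in every term `j ≤ k`. -/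
theorem pow_mul_expPartialSum_le {k : ℕ} {x t : ℝ} (hx : 0 ≤ x) (ht : 0 ≤ t) (ht1 : t ≤ 1) :
    t ^ (k + 1) * expPartialSum k x ≤ Real.exp (x * t) := by
  refine le_trans ?_ (expPartialSum_le_exp k (mul_nonneg hx ht))
  rw [expPartialSum, expPartialSum, Finset.mul_sum]
  refine Finset.sum_le_sum fun j hj => ?_
  have h : t ^ (k + 1) ≤ t ^ j := pow_le_pow_of_le_one ht ht1 (Finset.mem_range.1 hj).le
  calc t ^ (k + 1) * (1 / (j.factorial : ℝ) * x ^ j)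
      ≤ t ^ j * (1 / (j.factorial : ℝ) * x ^ j) := by gcongr
    _ = 1 / (j.factorial : ℝ) * (x * t) ^ j := by ring

theorem pow_mul_exp_sub_expPartialSum_le {k : ℕ} {x t : ℝ} (hx : 0 ≤ x) (ht1 : 1 ≤ t) :
    t ^ (k + 1) * (Real.exp x - expPartialSum k x) ≤ Real.exp (x * t) := by
  have ht : 0 ≤ t := by linarith
  have h1 : HasSum (fun j : ℕ => 1 / ((j + (k + 1)).factorial : ℝ) * x ^ (j + (k + 1)))
      (Real.exp x - expPartialSum k x) :=
    (hasSum_nat_add_iff' (k + 1)).2 (hasSum_exp_series x)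
  have h2 : HasSum (fun j : ℕ => 1 / ((j + (k + 1)).factorial : ℝ) * (x * t) ^ (j + (k + 1)))
      (Real.exp (x * t) - expPartialSum k (x * t)) :=
    (hasSum_nat_add_iff' (k + 1)).2 (hasSum_exp_series (x * t))
  refine le_trans (hasSum_le (fun j => ?_) (h1.mul_left (t ^ (k + 1))) h2)
    (sub_le_self _ (expPartialSum_nonneg k (mul_nonneg hx ht)))
  have h : t ^ (k + 1) ≤ t ^ (j + (k + 1)) := pow_le_pow_right₀ ht1 (Nat.le_add_left _ _)
  rw [mul_pow]
  calc t ^ (k + 1) * (1 / ((j + (k + 1)).factorial : ℝ) * x ^ (j + (k + 1)))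
      ≤ t ^ (j + (k + 1)) * (1 / ((j + (k + 1)).factorial : ℝ) * x ^ (j + (k + 1))) := by gcongr
    _ = _ := by ring

/-! ### Comparison of the Poisson and Gaussian densities -/

theorem abs_log_one_add_sub_le {r : ℝ} (hr : |r| ≤ 1 / 4) :
    |Real.log (1 + r) - r + r ^ 2 / 2| ≤ 4 / 3 * |r| ^ 3 := by
  have h := Real.abs_log_sub_add_sum_range_le (x := -r) (by rw [abs_neg]; linarith) 2
  rw [abs_neg] at h
  simp only [Finset.sum_range_succ, Finset.sum_range_zero] at h
  have h2 : |r| ^ (2 + 1) / (1 - |r|) ≤ 4 / 3 * |r| ^ 3 := by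
    rw [div_le_iff₀ (by linarith)]
    have := pow_nonneg (abs_nonneg r) 3
    nlinarith
  refine le_trans (le_of_eq ?_) (h.trans h2)
  congr 1
  push_cast
  ring_nf

theorem abs_log_one_add_le {r : ℝ} (hr : |r| ≤ 1 / 4) : |Real.log (1 + r)| ≤ 2 * |r| := by
  have h := abs_log_one_add_sub_le hr
  have h0 := abs_nonneg r
  have h3 : |r| ^ 3 ≤ 1 / 16 * |r| := by nlinarith [mul_nonneg h0 h0]
  have h4 : r ^ 2 ≤ 1 / 4 * |r| := by rw [← sq_abs]; nlinarith
  have := sq_nonneg r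
  rw [abs_le] at h ⊢
  constructor <;> linarith [le_abs_self r, neg_abs_le r]

theorem log_one_add_le {r : ℝ} (hr : |r| ≤ 1 / 4) : Real.log (1 + r) ≤ r - r ^ 2 / 6 := by
  have h := (abs_le.1 (abs_log_one_add_sub_le hr)).2
  have h3 : |r| ^ 3 ≤ 1 / 4 * r ^ 2 := by
    rw [← sq_abs r, pow_succ, mul_comm]
    gcongr
  linarith

theorem abs_exp_sub_exp_le_mul {a b M : ℝ} (ha : a ≤ M) (hb : b ≤ M) :
    |Real.exp a - Real.exp b| ≤ |a - b| * Real.exp M := by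
  wlog hab : b ≤ a generalizing a b
  · rw [abs_sub_comm, abs_sub_comm a]
    exact this hb ha (le_of_not_ge hab)
  rw [abs_of_nonneg (sub_nonneg.2 (Real.exp_le_exp.2 hab)), abs_of_nonneg (sub_nonneg.2 hab)]
  have h1 := Real.add_one_le_exp (b - a)
  have h2 : Real.exp b = Real.exp a * Real.exp (b - a) := by rw [← Real.exp_add]; ring_nf
  calc Real.exp a - Real.exp b ≤ (a - b) * Real.exp a := by
        rw [h2]; nlinarith [Real.exp_pos a]
    _ ≤ (a - b) * Real.exp M := by
        gcongr

theorem abs_pow_mul_exp_sub_exp_le (k : ℕ) {r : ℝ} (hr : |r| ≤ 1 / 4) :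
    |(1 + r) ^ k * Real.exp (-((k + 1 : ℝ) * r)) - Real.exp (-(k + 1 : ℝ) * r ^ 2 / 2)|
      ≤ 54 * |r| * Real.exp (-((k + 1 : ℝ) / 12) * r ^ 2) := by
  have hr' := abs_le.1 hr
  have hpos : 0 < 1 + r := by linarith
  have h1 := abs_log_one_add_sub_le hr
  have h2 := abs_log_one_add_le hr
  have h3 := log_one_add_le hr
  have hN : (0 : ℝ) ≤ k + 1 := by positivity
  set N : ℝ := (k : ℝ) + 1 with hNdef
  have hpow : (1 + r) ^ k = Real.exp ((N - 1) * Real.log (1 + r)) := by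
    rw [hNdef, add_sub_cancel_right, Real.exp_nat_mul, Real.exp_log hpos]
  rw [hpow, ← Real.exp_add]
  -- The `1/2` absorbs `-log(1+r)`, since `|log(1+r)| ≤ 2|r| ≤ 1/2`.
  have hM : (N - 1) * Real.log (1 + r) + -(N * r) ≤ 1 / 2 - N / 6 * r ^ 2 := by
    have := mul_le_mul_of_nonneg_left h3 hN
    have := neg_abs_le (Real.log (1 + r))
    linarith
  have hM' : -N * r ^ 2 / 2 ≤ 1 / 2 - N / 6 * r ^ 2 := by nlinarith [mul_nonneg hN (sq_nonneg r)]
  have hdiff : |(N - 1) * Real.log (1 + r) + -(N * r) - -N * r ^ 2 / 2|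
      ≤ 2 * |r| + 4 / 3 * N * |r| ^ 3 := by
    rw [show (N - 1) * Real.log (1 + r) + -(N * r) - -N * r ^ 2 / 2
      = N * (Real.log (1 + r) - r + r ^ 2 / 2) - Real.log (1 + r) by ring]
    refine (abs_sub _ _).trans ?_
    rw [abs_mul, abs_of_nonneg hN]
    nlinarith [mul_le_mul_of_nonneg_left h1 hN]
  refine (abs_exp_sub_exp_le_mul hM hM').trans ?_
  -- Half of the decay `e^{-Nr²/6}` is spent on the factor `N r²`; `18 = 2 + 16` because `4/3 · N =
  -- 16 · N/12`.
  have hsq : N / 12 * r ^ 2 ≤ Real.exp (N / 12 * r ^ 2) := by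
    linarith [Real.add_one_le_exp (N / 12 * r ^ 2)]
  have hone : 1 ≤ Real.exp (N / 12 * r ^ 2) := Real.one_le_exp (by positivity)
  have hhalf : Real.exp (1 / 2) ≤ 3 := by
    have := Real.exp_one_lt_d9
    have : Real.exp (1 / 2) ≤ Real.exp 1 := Real.exp_le_exp.2 (by norm_num)
    linarith
  have hbd : |(N - 1) * Real.log (1 + r) + -(N * r) - -N * r ^ 2 / 2|
      ≤ 18 * |r| * Real.exp (N / 12 * r ^ 2) := by
    refine hdiff.trans ?_
    have : |r| ^ 3 = |r| * r ^ 2 := by rw [← sq_abs r]; ring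
    rw [this]
    have h0 := abs_nonneg r
    nlinarith [mul_le_mul_of_nonneg_left hsq h0, mul_le_mul_of_nonneg_left hone h0]
  calc _ ≤ 18 * |r| * Real.exp (N / 12 * r ^ 2) * Real.exp (1 / 2 - N / 6 * r ^ 2) := by gcongr
    _ = Real.exp (1 / 2) * (18 * |r| * Real.exp (-(N / 12) * r ^ 2)) := by
        rw [mul_assoc, ← Real.exp_add, mul_left_comm, ← Real.exp_add]
        ring_nf
    _ ≤ 3 * (18 * |r| * Real.exp (-(N / 12) * r ^ 2)) := by gcongr
    _ = _ := by ring

/-- `-(B/2b) e^{-br²}` is a primitive of the bound and increases by at most `B/2b` on `[0, ∞)`. -/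
theorem abs_sub_le_of_abs_deriv_le_gaussian_of_nonneg {D D' : ℝ → ℝ} {B b ρ : ℝ} (hb : 0 < b)
    (hB : 0 ≤ B) (hD : ∀ r, HasDerivAt D (D' r) r)
    (hD' : ∀ r, |r| ≤ ρ → |D' r| ≤ B * |r| * Real.exp (-b * r ^ 2)) {r : ℝ} (hr0 : 0 ≤ r)
    (hr : r ≤ ρ) : |D r - D 0| ≤ B / (2 * b) := by
  have hH (r : ℝ) : HasDerivAt (fun r => -(B / (2 * b)) * Real.exp (-b * r ^ 2))
      (B * r * Real.exp (-b * r ^ 2)) r := by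
    convert! (((hasDerivAt_pow 2 r).const_mul (-b)).exp).const_mul (-(B / (2 * b))) using 1
    field_simp
    simp
    ring
  have key (E E' : ℝ → ℝ) (hE : ∀ r, HasDerivAt E (E' r) r)
      (hE' : ∀ r, |r| ≤ ρ → |E' r| ≤ B * |r| * Real.exp (-b * r ^ 2)) :
      E r - E 0 ≤ B / (2 * b) := by
    have hmono : MonotoneOn (fun r => -(B / (2 * b)) * Real.exp (-b * r ^ 2) - E r)
        (Set.Icc 0 ρ) := by
      refine monotoneOn_of_hasDerivWithinAt_nonneg (convex_Icc 0 ρ)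
        (fun s _ => ((hH s).sub (hE s)).continuousAt.continuousWithinAt)
        (fun s _ => ((hH s).sub (hE s)).hasDerivWithinAt) fun s hs => ?_
      rw [interior_Icc] at hs
      have h := (le_abs_self _).trans (hE' s (by rw [abs_of_pos hs.1]; exact hs.2.le))
      rw [abs_of_pos hs.1] at h
      linarith
    have h := hmono ⟨le_rfl, hr0.trans hr⟩ ⟨hr0, hr⟩ hr0
    have hpos : 0 ≤ B / (2 * b) * Real.exp (-b * r ^ 2) := by positivity
    simp only [ne_eq, OfNat.ofNat_ne_zero, not_false_eq_true, zero_pow, mul_zero, Real.exp_zero,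
      mul_one] at h
    linarith
  rw [abs_le]
  have h1 := key D D' hD hD'
  have h2 := key (fun r => -D r) (fun r => -D' r) (fun r => (hD r).neg)
    fun r hr => by rw [abs_neg]; exact hD' r hr
  constructor <;> linarith

theorem abs_sub_le_of_abs_deriv_le_gaussian {D D' : ℝ → ℝ} {B b ρ : ℝ} (hb : 0 < b)
    (hB : 0 ≤ B) (hD : ∀ r, HasDerivAt D (D' r) r)
    (hD' : ∀ r, |r| ≤ ρ → |D' r| ≤ B * |r| * Real.exp (-b * r ^ 2)) {r : ℝ}
    (hr : |r| ≤ ρ) : |D r - D 0| ≤ B / (2 * b) := by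
  rcases le_total 0 r with h0 | h0
  · exact abs_sub_le_of_abs_deriv_le_gaussian_of_nonneg hb hB hD hD' h0
      (by rwa [abs_of_nonneg h0] at hr)
  · have h := abs_sub_le_of_abs_deriv_le_gaussian_of_nonneg (D := fun r => D (-r))
      (D' := fun r => -D' (-r)) hb hB (fun s => by simpa using! (hD (-s)).comp s (hasDerivAt_neg s))
      (fun s hs => by simpa using hD' (-s) (by rwa [abs_neg])) (neg_nonneg.2 h0)
      (by rwa [abs_of_nonpos h0] at hr)
    simpa using h

/-! ### Tail bounds and Stirling -/

theorem one_add_pow_mul_exp_neg_le (k : ℕ) {r : ℝ} (hr : |r| ≤ 1 / 4) :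
    (1 + r) ^ (k + 1) * Real.exp (-((k + 1 : ℝ) * r)) ≤ Real.exp (-((k + 1 : ℝ) * r ^ 2 / 6)) := by
  have hpos : 0 < 1 + r := by linarith [(abs_le.1 hr).1]
  have hN : (0 : ℝ) ≤ k + 1 := by positivity
  have hpow : (1 + r) ^ (k + 1) = Real.exp ((k + 1 : ℝ) * Real.log (1 + r)) := by
    rw [← Real.exp_log hpos, ← Real.exp_nat_mul, Real.log_exp]
    push_cast
    rfl
  rw [hpow, ← Real.exp_add]
  apply Real.exp_le_exp.2
  have := mul_le_mul_of_nonneg_left (log_one_add_le hr) hN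
  linarith

theorem expPartialSum_div_exp_le (k : ℕ) {r : ℝ} (hr0 : 0 ≤ r) (hr : r ≤ 1 / 4) :
    expPartialSum k ((k + 1 : ℝ) * (1 + r)) / Real.exp ((k + 1 : ℝ) * (1 + r))
      ≤ Real.exp (-((k + 1 : ℝ) * r ^ 2 / 6)) := by
  have hpos : 0 < 1 + r := by linarith
  refine le_trans ?_ (one_add_pow_mul_exp_neg_le k (by rwa [abs_of_nonneg hr0]))
  -- This `t` is the optimal Chernoff parameter: `xt = k + 1`.
  have h := pow_mul_expPartialSum_le (k := k) (x := (k + 1 : ℝ) * (1 + r)) (t := (1 + r)⁻¹)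
    (by positivity) (by positivity) (inv_le_one_of_one_le₀ (by linarith))
  rw [mul_inv_cancel_right₀ hpos.ne', inv_pow, inv_mul_le_iff₀ (by positivity)] at h
  rw [div_le_iff₀ (Real.exp_pos _), mul_assoc, ← Real.exp_add]
  convert h using 3
  ring

theorem one_sub_expPartialSum_div_exp_le (k : ℕ) {r : ℝ} (hr0 : r ≤ 0) (hr : -(1 / 4) ≤ r) :
    1 - expPartialSum k ((k + 1 : ℝ) * (1 + r)) / Real.exp ((k + 1 : ℝ) * (1 + r))
      ≤ Real.exp (-((k + 1 : ℝ) * r ^ 2 / 6)) := by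
  have hpos : 0 < 1 + r := by linarith
  refine le_trans ?_ (one_add_pow_mul_exp_neg_le k (by rw [abs_of_nonpos hr0]; linarith))
  have h := pow_mul_exp_sub_expPartialSum_le (k := k) (x := (k + 1 : ℝ) * (1 + r))
    (t := (1 + r)⁻¹) (by positivity) ((one_le_inv₀ hpos).2 (by linarith))
  rw [mul_inv_cancel_right₀ hpos.ne', inv_pow, inv_mul_le_iff₀ (by positivity)] at h
  rw [one_sub_div (Real.exp_pos _).ne', div_le_iff₀ (Real.exp_pos _), mul_assoc, ← Real.exp_add]
  convert h using 3
  ring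

theorem exp_neg_div_le {N : ℝ} (hN : 1 ≤ N) : Real.exp (-(N / 96)) ≤ 96 / Real.sqrt N := by
  have hs : 0 < Real.sqrt N := Real.sqrt_pos.2 (by linarith)
  have h1 : Real.sqrt N ≤ N := Real.sqrt_le_iff.2 ⟨by linarith, by nlinarith⟩
  have h2 := Real.add_one_le_exp (N / 96)
  rw [Real.exp_neg, inv_le_comm₀ (Real.exp_pos _) (by positivity), inv_div]
  linarith

theorem antitoneOn_expPartialSum_div_exp (k : ℕ) :
    AntitoneOn (fun x => expPartialSum k x / Real.exp x) (Set.Ici 0) := by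
  refine antitoneOn_of_hasDerivWithinAt_nonpos (convex_Ici 0)
    (fun x _ => (hasDerivAt_expPartialSum_div_exp k x).continuousAt.continuousWithinAt)
    (fun x _ => (hasDerivAt_expPartialSum_div_exp k x).hasDerivWithinAt) fun x hx => ?_
  rw [interior_Ici] at hx
  have : 0 < x := hx
  exact neg_nonpos.2 (by positivity)

theorem sqrt_two_pi_mul_pow_mul_exp_neg_le (k : ℕ) :
    Real.sqrt (2 * Real.pi) * Real.sqrt (k + 1) * ((k + 1 : ℝ) ^ k / k.factorial
      * Real.exp (-(k + 1))) ≤ 1 := by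
  have h := Stirling.le_factorial_stirling (k + 1)
  rw [Real.sqrt_mul (by positivity), Nat.factorial_succ, div_pow, ← Real.exp_nat_mul, mul_one] at h
  push_cast at h
  rw [Real.exp_neg]
  have hN : (0 : ℝ) < k + 1 := by positivity
  have hf : (0 : ℝ) < k.factorial := by positivity
  have he := Real.exp_pos ((k : ℝ) + 1)
  rw [pow_succ, mul_div_assoc', div_le_iff₀ he] at h
  rw [← mul_assoc, ← div_eq_mul_inv, div_le_one he, mul_div_assoc', div_le_iff₀ hf]
  refine le_of_mul_le_mul_left ?_ hN
  linarith

/-! ### Assembly -/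

theorem abs_expPartialSum_div_exp_sub_gaussErf_le (k : ℕ) {r : ℝ} (hr : -1 ≤ r) :
    |expPartialSum k ((k + 1 : ℝ) * (1 + r)) / Real.exp ((k + 1 : ℝ) * (1 + r))
      - gaussErf (-(Real.sqrt (k + 1) * r))| ≤ 1500 / Real.sqrt (k + 1) := by
  have hN : (1 : ℝ) ≤ k + 1 := by linarith [Nat.cast_nonneg (α := ℝ) k]
  have hstir := sqrt_two_pi_mul_pow_mul_exp_neg_le k
  have htail := exp_neg_div_le hN
  have hub := expPartialSum_div_exp_le k (r := 1 / 4) (by norm_num) le_rfl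
  have hlb := one_sub_expPartialSum_div_exp_le k (r := -(1 / 4)) (by norm_num) le_rfl
  have hbound := fun r hr => abs_pow_mul_exp_sub_exp_le k (r := r) hr
  have hnn (r : ℝ) (hr : -1 ≤ r) : (0 : ℝ) ≤ (k + 1) * (1 + r) := by
    have : 0 ≤ 1 + r := by linarith
    positivity
  have hder (r : ℝ) := (hasDerivAt_expPartialSum_div_exp k ((k + 1 : ℝ) * (1 + r))).comp r
    (((hasDerivAt_id r).const_add 1).const_mul (k + 1 : ℝ))
  have hanti {r r' : ℝ} (h : -1 ≤ r) (h' : r ≤ r') :=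
    antitoneOn_expPartialSum_div_exp k (hnn r h) (hnn r' (h.trans h'))
      (by gcongr : (k + 1 : ℝ) * (1 + r) ≤ (k + 1) * (1 + r'))
  have hP0 (r : ℝ) (hr : -1 ≤ r) :
      0 ≤ expPartialSum k ((k + 1 : ℝ) * (1 + r)) / Real.exp ((k + 1 : ℝ) * (1 + r)) :=
    div_nonneg (expPartialSum_nonneg k (hnn r hr)) (Real.exp_pos _).le
  have hP1 (r : ℝ) (hr : -1 ≤ r) :
      expPartialSum k ((k + 1 : ℝ) * (1 + r)) / Real.exp ((k + 1 : ℝ) * (1 + r)) ≤ 1 :=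
    (div_le_one (Real.exp_pos _)).2 (expPartialSum_le_exp k (hnn r hr))
  set N : ℝ := (k : ℝ) + 1 with hNdef
  set s := Real.sqrt N with hs
  have hspos : 0 < s := Real.sqrt_pos.2 (by linarith)
  have hss : s * s = N := Real.mul_self_sqrt (by linarith)
  set M := 1 / s with hM
  have hMdiv (c : ℝ) : c / s = c * M := by rw [hM, mul_one_div]
  set P : ℝ → ℝ := fun r => expPartialSum k (N * (1 + r)) / Real.exp (N * (1 + r)) with hP
  set Q : ℝ → ℝ := fun r => gaussErf (-(s * r)) with hQ
  change |P r - Q r| ≤ 1500 / s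
  have hQ0 (r : ℝ) : 0 ≤ Q r := gaussErf_nonneg _
  have hQsum (r : ℝ) : Q r + Q (-r) = 1 := by
    simp only [hQ, mul_neg]
    exact gaussErf_add_gaussErf_neg _
  have hQ1 (r : ℝ) : Q r ≤ 1 := by linarith [hQsum r, hQ0 (-r)]
  have hQanti : Antitone Q := fun a b hab => monotone_gaussErf (by gcongr)
  have hQub : Q (1 / 4) ≤ 8 * M := by
    refine (gaussErf_neg_le (by positivity : 0 < s * (1 / 4))).trans (le_of_eq ?_)
    rw [hM]
    field_simp
    norm_num
  have hQlb : 1 - 8 * M ≤ Q (-(1 / 4)) := by linarith [hQsum (1 / 4)]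
  rw [hMdiv] at htail ⊢
  have hPub : P (1 / 4) ≤ 96 * M := by
    refine hub.trans (le_trans (le_of_eq ?_) htail)
    ring_nf
  have hPlb : 1 - 96 * M ≤ P (-(1 / 4)) := by
    have : 1 - P (-(1 / 4)) ≤ 96 * M := by
      refine hlb.trans (le_trans (le_of_eq ?_) htail)
      ring_nf
    linarith
  have hMpos : 0 < M := by positivity
  rcases lt_or_ge r (-(1 / 4)) with hlt | hge
  · have h1 : P (-(1 / 4)) ≤ P r := hanti hr hlt.le
    have h2 := hQanti hlt.le
    have h3 : P r ≤ 1 := hP1 r hr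
    rw [abs_le]
    constructor <;> linarith [hQ1 r]
  rcases lt_or_ge (1 / 4) r with hgt | hle
  · have h1 : P r ≤ P (1 / 4) := hanti (by norm_num) hgt.le
    have h2 := hQanti hgt.le
    have h3 : 0 ≤ P r := hP0 r hr
    rw [abs_le]
    constructor <;> linarith [hQ0 r]
  have hw : 0 < Real.sqrt (2 * Real.pi) := Real.sqrt_pos.2 (by positivity)
  set w := Real.sqrt (2 * Real.pi)
  set a := N ^ k / k.factorial * Real.exp (-N) with ha
  have hapos : 0 < a := by positivity
  have hw1 : 1 ≤ w := Real.one_le_sqrt.2 (by linarith [Real.pi_gt_three])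
  have hD (r : ℝ) : HasDerivAt (fun r => P r - w * s * a * Q r)
      (-(N * a) * ((1 + r) ^ k * Real.exp (-(N * r)) - Real.exp (-N * r ^ 2 / 2))) r := by
    have hQd := (hasDerivAt_gaussErf (-(s * r))).comp r ((hasDerivAt_id r).const_mul s).neg
    convert! (hder r).sub (hQd.const_mul (w * s * a)) using 1
    rw [show -(1 / 2) * (-(s * r)) ^ 2 = -N * r ^ 2 / 2 by rw [← hss]; ring,
      show -(N * (1 + r)) = -N + -(N * r) by ring, Real.exp_add, ha, mul_pow]
    field_simp
    rw [← hss]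
    ring
  have hsa : s * a ≤ 1 := by nlinarith [mul_pos hspos hapos]
  have hest (r : ℝ) (hr : |r| ≤ 1 / 4) :=
    abs_sub_le_of_abs_deriv_le_gaussian (B := 54 * (N * a)) (b := N / 12) (by positivity)
      (by positivity) hD (fun r hr => by
        rw [abs_mul, abs_neg, abs_of_pos (by positivity)]
        calc _ ≤ N * a * (54 * |r| * Real.exp (-(N / 12) * r ^ 2)) := by
              gcongr
              exact hbound r hr
          _ = _ := by ring) hr
  have hB : 54 * (N * a) / (2 * (N / 12)) ≤ 324 * M := by
    rw [show 54 * (N * a) / (2 * (N / 12)) = 324 * a by field_simp; norm_num]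
    gcongr
    rw [hM, le_div_iff₀ hspos, mul_comm]
    exact hsa
  set c := w * s * a
  have hc0 : 0 ≤ c := by positivity
  have hc1 : c ≤ 1 := hstir
  have e1 := abs_le.1 ((hest (1 / 4) (by norm_num [abs_of_pos])).trans hB)
  have e2 := abs_le.1 ((hest (-(1 / 4)) (by norm_num [abs_of_pos])).trans hB)
  have e3 := abs_le.1 ((hest r (abs_le.2 ⟨hge, hle⟩)).trans hB)
  have p1 : c * Q (1 / 4) ≤ Q (1 / 4) := mul_le_of_le_one_left (hQ0 _) hc1
  have p3 : (1 - c) * Q r ≤ 1 - c := mul_le_of_le_one_right (by linarith) (hQ1 _)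
  have p4 : 0 ≤ (1 - c) * Q r := mul_nonneg (by linarith) (hQ0 _)
  have p5 : 0 ≤ c * Q (1 / 4) := mul_nonneg hc0 (hQ0 _)
  have p6 : 0 ≤ P (1 / 4) := hP0 _ (by norm_num)
  have p2 : c * Q (-(1 / 4)) ≤ c := mul_le_of_le_one_right hc0 (hQ1 _)
  -- `840 = 2·324 + 2·96`: the variation of `P - cQ` between the endpoints, plus the two tails of
  -- `P`.
  have hc : 1 - c ≤ 840 * M := by linarith [e1.1, e1.2, e2.1, e2.2]
  rw [abs_le]
  -- `P - Q = (P - cQ) - (1 - c)Q`; the lower bound costs `2·324 + 8 + 840 = 1496`.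
  constructor <;> linarith [e1.1, e1.2, e3.1, e3.2]

theorem mainTheorem10 :
    ∃ C : ℝ, ∀ n : ℕ, 1 ≤ n → ∀ x : ℝ, 0 ≤ x →
      |expPartialSum (n - 1) x / Real.exp x - gaussErf (((n : ℝ) - x) / Real.sqrt n)|
        ≤ C / Real.sqrt n := by
  refine ⟨1500, fun n hn x hx => ?_⟩
  obtain ⟨k, rfl⟩ := Nat.exists_eq_add_of_le' hn
  have hN : (0 : ℝ) < k + 1 := by positivity
  have h := abs_expPartialSum_div_exp_sub_gaussErf_le k (r := x / (k + 1) - 1)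
    (by linarith [div_nonneg hx hN.le])
  rw [add_sub_cancel, mul_div_cancel₀ x hN.ne'] at h
  rw [Nat.add_sub_cancel]
  push_cast
  convert h using 4
  rw [div_eq_iff (Real.sqrt_pos.2 hN).ne']
  have hss := Real.mul_self_sqrt hN.le
  rw [neg_mul, mul_right_comm, hss]
  field_simp
  ring
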